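/- Let $d\ge 0$ be an integer, let $E=\mathbb{Q}^2$ with its standard basis, and let $\sigma_d:\mathbb{Q}\,\mathsf{GL}_2(\mathbb{Q})\to\operatorname{End}_{\mathbb{Q}}(E^{\otimes d})$ be the linear extension to the group algebra of the diagonal action $g\mapsto g\otimes\cdots\otimes g$. The Schur algebra $S(2,d)$ over $\mathbb{Q}$ is the image of $\sigma_d$. For $X\in\mathfrak{gl}_2(\mathbb{Q})$ put $\rho_d(X)=\sum_{i=1}^d 1^{\otimes(i-1)}\otimes X\otimes 1^{\otimes(d-i)}$, the differential of the diagonal action of $\mathsf{GL}_2(\mathbb{Q})$. Then $S(2,d)$ is isomorphic to the associative $\mathbb{Q}$-algebra with $1$ generated by $e,f,H_2$ subject to the relations $$H_2e-eH_2=-e,\qquad ef-fe=d-2H_2,\qquad H_2f-fH_2=f,$$ $$H_2(H_2-1)\cdots(H_2-d)=0,$$ via an isomorphism of $\mathbb{Q}$-algebras sending the generators $e,f,H_2$ to $\rho_d(e_{12}),\rho_d(e_{21}),\rho_d(e_{22})$ respectively, where the $e_{ij}$ are the matrix units. Moreover, the monomials $f^aH_2^be^c$ with integers $a,b,c\ge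 0$ and $a+b+c\le d$ are pairwise distinct and form a $\mathbb{Q}$-basis of this algebra. -/

import Mathlib

open scoped TensorProduct

namespace SchurTwo

noncomputable section

/-- The natural module `E = ℚ²` with its canonical basis. -/
abbrev E : Type := Fin 2 → ℚ

/-- Tensor space `E^{⊗ d}`. -/
abbrev TensorSpace (d : ℕ) : Type := ⨂[ℚ] (_ : Fin d), E

/-- The diagonal representation `σ_d` of `GL₂(ℚ)` on tensor space:
`g ↦ g ⊗ g ⊗ ⋯ ⊗ g`. -/
def sigma (d : ℕ) : Representation ℚ (GL (Fin 2) ℚ) (TensorSpace d) where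
  toFun g := PiTensorProduct.map fun _ => Matrix.toLin' (g : Matrix (Fin 2) (Fin 2) ℚ)
  map_one' := by
    simp only [Units.val_one, Matrix.toLin'_one]
    exact PiTensorProduct.map_id
  map_mul' g h := by
    simp only [Units.val_mul, Matrix.toLin'_mul]
    exact PiTensorProduct.map_comp _ _

/-- The Schur algebra `S(2,d)` over `ℚ`: the image of the group algebra `ℚ GL₂(ℚ)` in
`End(E^{⊗ d})` under the linear extension of `σ_d`. -/
def schurAlgebra (d : ℕ) : Subalgebra ℚ (Module.End ℚ (TensorSpace d)) :=
  (sigma d).asAlgebraHom.range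

/-- The differential `ρ_d` of `σ_d`, the action of the Lie algebra `gl₂(ℚ)` on tensor space:
`X ↦ ∑ i, 1 ⊗ ⋯ ⊗ X ⊗ ⋯ ⊗ 1` with `X` in position `i`. -/
def rho (d : ℕ) (X : Matrix (Fin 2) (Fin 2) ℚ) : Module.End ℚ (TensorSpace d) :=
  ∑ i : Fin d,
    PiTensorProduct.map
      (Function.update (fun _ : Fin d => (LinearMap.id : E →ₗ[ℚ] E)) i (Matrix.toLin' X))

/-- The names of the three generators. -/
inductive Gen : Type
  | e
  | f
  | H₂

/-- The product `T (T - 1) ⋯ (T - d)` in a `ℚ`-algebra. -/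
def fallingProduct {A : Type*} [Ring A] (d : ℕ) (T : A) : A :=
  ((List.range (d + 1)).map fun k : ℕ => T - (k : A)).prod

/-- The defining relations, in the free associative unital `ℚ`-algebra on `e`, `f`, `H₂`. -/
inductive Rel (d : ℕ) : FreeAlgebra ℚ Gen → FreeAlgebra ℚ Gen → Prop
  | H₂_e : Rel d
      (FreeAlgebra.ι ℚ Gen.H₂ * FreeAlgebra.ι ℚ Gen.e
        - FreeAlgebra.ι ℚ Gen.e * FreeAlgebra.ι ℚ Gen.H₂)
      (-FreeAlgebra.ι ℚ Gen.e)
  | e_f : Rel d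
      (FreeAlgebra.ι ℚ Gen.e * FreeAlgebra.ι ℚ Gen.f
        - FreeAlgebra.ι ℚ Gen.f * FreeAlgebra.ι ℚ Gen.e)
      ((d : FreeAlgebra ℚ Gen) - 2 * FreeAlgebra.ι ℚ Gen.H₂)
  | H₂_f : Rel d
      (FreeAlgebra.ι ℚ Gen.H₂ * FreeAlgebra.ι ℚ Gen.f
        - FreeAlgebra.ι ℚ Gen.f * FreeAlgebra.ι ℚ Gen.H₂)
      (FreeAlgebra.ι ℚ Gen.f)
  | minpoly : Rel d (fallingProduct d (FreeAlgebra.ι ℚ Gen.H₂)) 0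

/-- The associative unital `ℚ`-algebra generated by `e`, `f`, `H₂` subject to the relations
`Rel d`. -/
abbrev Presented (d : ℕ) : Type := RingQuot (Rel d)

/-- The class of a generator in the presented algebra. -/
def gen (d : ℕ) (x : Gen) : Presented d :=
  RingQuot.mkAlgHom ℚ (Rel d) (FreeAlgebra.ι ℚ x)

/-- The matrix in `gl₂(ℚ)` named by a generator: `e = e₁₂`, `f = e₂₁`, `H₂ = e₂₂`. -/
def Gen.toMatrix : Gen → Matrix (Fin 2) (Fin 2) ℚ
  | .e => !![0, 1; 0, 0]
  | .f => !![0, 0; 1, 0]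
  | .H₂ => !![0, 0; 0, 1]

/-- The exponents `(a, b, c)` with `a + b + c ≤ d`. -/
abbrev Exponent (d : ℕ) : Type := {t : ℕ × ℕ × ℕ // t.1 + t.2.1 + t.2.2 ≤ d}

end

end SchurTwo

/-! The proof compares two bounds on dimension. Straightening shows that the monomials `f ^ a * h ^
b * e ^ c` of degree at most `d` span the presented algebra. Commuting an element with `e` or `f`
does not raise its degree, and modulo degree at most `d` it turns `h ^ (b + 1) * e ^ c` into `(b +
1) • (h ^ b * e ^ (c + 1))`, and similarly on the `f` side. Since the relation `fallingProduct d h =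
0` puts `h ^ (d + 1)` in degree at most `d`, every monomial of degree `d + 1` follows, because `b +
1` is invertible (`CommRels.monomial_mem`).

The operators `rho d` satisfy the relations, the last one because `H₂` acts on a standard basis
tensor by the number of its factors equal to the second basis vector. The resulting operators on
tensor space are linearly independent: suitable matrix coefficients isolate those of largest `a +
c`, where what remains is a polynomial of small degree with many roots
(`rho_monomials_independent`). Hence the monomials are a basis and `toEnd` is injective.

Its image lies in the Schur algebra by a polynomial argument in `n` applied to `1 + n • X`
(`rho_mem_schurAlgebra`). Conversely the Schur algebra is spanned by sums of tensor products of
matrix units, one for each exponent triple (`schurAlgebra_le_span`), so its dimension is at most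
that of the image, and the two coincide. -/

open scoped TensorProduct

namespace SchurTwo

noncomputable section

/-! ### Straightening: reduction of monomials of degree one too high -/

section Straightening

set_option linter.unusedSectionVars false

variable {A : Type*} [Ring A] [Algebra ℚ A]

/-- The span of the powers `h ^ k` with `k < m`. -/
def powSpan (h : A) (m : ℕ) : Submodule ℚ A :=
  Submodule.span ℚ ((fun k => h ^ k) '' {k | k < m})

/-- The span of the monomials `f ^ a * h ^ b * e ^ c` with `a + b + c ≤ n`. -/
def monomialSpan (e f h : A) (n : ℕ) : Submodule ℚ A :=
  Submodule.span ℚ {x | ∃ a b c, a + b + c ≤ n ∧ x = f ^ a * h ^ b * e ^ c}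

theorem pow_mem_powSpan (h : A) {k m : ℕ} (hk : k < m) : h ^ k ∈ powSpan h m :=
  Submodule.subset_span ⟨k, hk, rfl⟩

theorem powSpan_mono (h : A) {m n : ℕ} (hmn : m ≤ n) : powSpan h m ≤ powSpan h n :=
  Submodule.span_mono (Set.image_mono fun _ hk => lt_of_lt_of_le hk hmn)

theorem powSpan_mul_mem {h p q : A} {m n : ℕ} (hp : p ∈ powSpan h m)
    (hq : q ∈ powSpan h (n + 1)) : p * q ∈ powSpan h (m + n) := by
  have key : powSpan h m * powSpan h (n + 1) ≤ powSpan h (m + n) := by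
    rw [powSpan, powSpan, Submodule.span_mul_span, Submodule.span_le]
    rintro _ ⟨_, ⟨i, hi, rfl⟩, _, ⟨j, hj, rfl⟩, rfl⟩
    simp only [Set.mem_ofPred_eq] at hi hj
    simp only [← pow_add]
    exact pow_mem_powSpan h (by omega)
  exact key (Submodule.mul_mem_mul hp hq)

/-- Moving `e` or `f` past `h` shifts `h` by one, so this difference governs commutators; its
leading coefficient `b + 1` is what gets inverted later. -/
theorem add_one_pow_sub_mem (h : A) (b : ℕ) :
    (h + 1) ^ (b + 1) - h ^ (b + 1) - ((b : ℚ) + 1) • h ^ b ∈ powSpan h b := by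
  have : (h + 1) ^ (b + 1) - h ^ (b + 1) - ((b : ℚ) + 1) • h ^ b =
      ∑ k ∈ Finset.range b, ((b + 1).choose k : ℚ) • h ^ k := by
    rw [(Commute.one_right h).add_pow, Finset.sum_range_succ, Finset.sum_range_succ]
    have hc : ∀ k : ℕ, h ^ k * 1 ^ (b + 1 - k) * ((b + 1).choose k : A) =
        ((b + 1).choose k : ℚ) • h ^ k := by
      intro k
      rw [one_pow, mul_one, Algebra.smul_def, map_natCast, Nat.cast_comm]
    simp only [hc]
    simp only [Nat.choose_self, Nat.choose_succ_self_right]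
    push_cast
    rw [one_smul]
    abel
  rw [this]
  exact Submodule.sum_mem _ fun k hk =>
    Submodule.smul_mem _ _ (pow_mem_powSpan h (Finset.mem_range.1 hk))

theorem add_one_pow_sub_pow_mem (h : A) (b : ℕ) : (h + 1) ^ b - h ^ b ∈ powSpan h b := by
  cases b with
  | zero => simp
  | succ b =>
    have h1 := powSpan_mono h b.le_succ (add_one_pow_sub_mem h b)
    have h2 := Submodule.smul_mem _ ((b : ℚ) + 1) (pow_mem_powSpan h b.lt_succ_self)
    simpa using Submodule.add_mem _ h1 h2

theorem add_one_pow_mem (h : A) {b m : ℕ} (hb : b < m) : (h + 1) ^ b ∈ powSpan h m := by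
  simpa using Submodule.add_mem _ (powSpan_mono h hb.le (add_one_pow_sub_pow_mem h b))
    (pow_mem_powSpan h hb)

theorem fallingProduct_sub_pow_mem (h : A) (n : ℕ) :
    fallingProduct n h - h ^ (n + 1) ∈ powSpan h (n + 1) := by
  have key : ∀ m : ℕ, ((List.range m).map fun k : ℕ => h - (k : A)).prod - h ^ m ∈
      powSpan h m := by
    intro m
    induction m with
    | zero => simp
    | succ m ih =>
      rw [List.range_succ, List.map_append, List.prod_append, List.map_singleton,
        List.prod_singleton]
      set p := ((List.range m).map fun k : ℕ => h - (k : A)).prod with hp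
      have e1 : p * (h - m) - h ^ (m + 1) =
          (p - h ^ m) * h - ((m : ℚ) • (p - h ^ m) + (m : ℚ) • h ^ m) := by
        rw [← smul_add, sub_add_cancel, Algebra.smul_def, map_natCast, Nat.cast_comm, mul_sub,
          sub_mul, pow_succ]
        abel
      rw [e1]
      refine Submodule.sub_mem _ ?_ (Submodule.add_mem _ ?_ ?_)
      · exact powSpan_mul_mem (n := 1) ih
          (by simpa using pow_mem_powSpan h (show 1 < 1 + 1 by norm_num))
      · exact Submodule.smul_mem _ _ (powSpan_mono h m.le_succ ih)
      · exact Submodule.smul_mem _ _ (pow_mem_powSpan h m.lt_succ_self)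
  exact key (n + 1)

/-- The top power in `powSpan h m` is `m - 1`, whence the bound `n + 1`. For `m = 0` the space is
zero, which covers `(h + 1) ^ 0 - h ^ 0` in the commutator lemmas. -/
theorem mem_monomialSpan {e f h q : A} {m : ℕ} (hq : q ∈ powSpan h m) {a c n : ℕ}
    (hn : a + c + m ≤ n + 1) : f ^ a * q * e ^ c ∈ monomialSpan e f h n := by
  induction hq using Submodule.span_induction with
  | mem x hx =>
    obtain ⟨k, hk, rfl⟩ := hx
    simp only [Set.mem_ofPred_eq] at hk
    exact Submodule.subset_span ⟨a, k, c, by omega, rfl⟩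
  | zero => simp
  | add x y _ _ hx hy =>
    rw [mul_add, add_mul]
    exact Submodule.add_mem _ hx hy
  | smul r x _ hx =>
    rw [mul_smul_comm, smul_mul_assoc]
    exact Submodule.smul_mem _ _ hx

theorem monomialSpan_mono (e f h : A) {m n : ℕ} (hmn : m ≤ n) :
    monomialSpan e f h m ≤ monomialSpan e f h n :=
  Submodule.span_mono fun _ ⟨a, b, c, hm, hx⟩ => ⟨a, b, c, hm.trans hmn, hx⟩

/-- The commutation relations of `e = e₁₂`, `f = e₂₁`, `h = e₂₂` in `gl₂`, with `e₁₁ + e₂₂`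
acting as the scalar `d`. -/
structure CommRels (d : ℕ) (e f h : A) : Prop where
  h_e : h * e - e * h = -e
  e_f : e * f - f * e = (d : A) - 2 * h
  h_f : h * f - f * h = f

theorem CommRels.pow_mul_f {d : ℕ} {e f h : A} (H : CommRels d e f h) (b : ℕ) :
    h ^ b * f = f * (h + 1) ^ b := by
  have : SemiconjBy f (h + 1) h := by
    rw [SemiconjBy, mul_add, mul_one]
    exact (sub_eq_iff_eq_add'.1 H.h_f).symm
  exact (this.pow_right b).eq.symm

theorem CommRels.e_mul_pow {d : ℕ} {e f h : A} (H : CommRels d e f h) (b : ℕ) :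
    e * h ^ b = (h + 1) ^ b * e := by
  have : SemiconjBy e h (h + 1) := by
    rw [SemiconjBy, add_mul, one_mul, sub_eq_iff_eq_add.1 H.h_e]
    abel
  exact (this.pow_right b).eq

theorem CommRels.exists_mul_f {d : ℕ} {e f h : A} (H : CommRels d e f h) {m : ℕ} {q : A}
    (hq : q ∈ powSpan h m) : ∃ q' ∈ powSpan h m, q * f = f * q' := by
  induction hq using Submodule.span_induction with
  | mem x hx =>
    obtain ⟨k, hk, rfl⟩ := hx
    exact ⟨_, add_one_pow_mem h hk, H.pow_mul_f k⟩
  | zero => exact ⟨0, Submodule.zero_mem _, by simp⟩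
  | add x y _ _ hx hy =>
    obtain ⟨x', hx', ex⟩ := hx
    obtain ⟨y', hy', ey⟩ := hy
    exact ⟨_, Submodule.add_mem _ hx' hy', by rw [add_mul, mul_add, ex, ey]⟩
  | smul r x _ hx =>
    obtain ⟨x', hx', ex⟩ := hx
    exact ⟨_, Submodule.smul_mem _ r hx', by rw [smul_mul_assoc, mul_smul_comm, ex]⟩

theorem CommRels.exists_e_mul {d : ℕ} {e f h : A} (H : CommRels d e f h) {m : ℕ} {q : A}
    (hq : q ∈ powSpan h m) : ∃ q' ∈ powSpan h m, e * q = q' * e := by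
  induction hq using Submodule.span_induction with
  | mem x hx =>
    obtain ⟨k, hk, rfl⟩ := hx
    exact ⟨_, add_one_pow_mem h hk, H.e_mul_pow k⟩
  | zero => exact ⟨0, Submodule.zero_mem _, by simp⟩
  | add x y _ _ hx hy =>
    obtain ⟨x', hx', ex⟩ := hx
    obtain ⟨y', hy', ey⟩ := hy
    exact ⟨_, Submodule.add_mem _ hx' hy', by rw [add_mul, mul_add, ex, ey]⟩
  | smul r x _ hx =>
    obtain ⟨x', hx', ex⟩ := hx
    exact ⟨_, Submodule.smul_mem _ r hx', by rw [smul_mul_assoc, mul_smul_comm, ex]⟩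

theorem weight_mem_powSpan (d : ℕ) (h : A) : (d : A) - 2 * h ∈ powSpan h 2 := by
  have h0 := Submodule.smul_mem _ (d : ℚ) (pow_mem_powSpan h (show 0 < 2 by norm_num))
  have h1 := Submodule.smul_mem _ (2 : ℚ) (pow_mem_powSpan h (show 1 < 2 by norm_num))
  simpa [Algebra.smul_def, map_ofNat] using Submodule.sub_mem _ h0 h1

theorem CommRels.exists_e_mul_f_pow {d : ℕ} {e f h : A} (H : CommRels d e f h) (a : ℕ) :
    ∃ q ∈ powSpan h 2, e * f ^ (a + 1) = f ^ (a + 1) * e + f ^ a * q := by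
  induction a with
  | zero =>
    refine ⟨_, weight_mem_powSpan d h, ?_⟩
    rw [← H.e_f]
    simp
  | succ a ih =>
    obtain ⟨q, hq, hfq⟩ := ih
    obtain ⟨q', hq', hqf⟩ := H.exists_mul_f hq
    refine ⟨_, Submodule.add_mem _ (weight_mem_powSpan d h) hq', ?_⟩
    rw [pow_succ f (a + 1), ← mul_assoc, hfq, add_mul, mul_assoc (f ^ a), hqf, mul_assoc _ e,
      sub_eq_iff_eq_add.1 H.e_f, mul_add, mul_add, ← mul_assoc (f ^ a), ← pow_succ, ← mul_assoc _ f]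
    abel

theorem CommRels.exists_e_pow_mul_f {d : ℕ} {e f h : A} (H : CommRels d e f h) (c : ℕ) :
    ∃ q ∈ powSpan h 2, e ^ (c + 1) * f = f * e ^ (c + 1) + q * e ^ c := by
  induction c with
  | zero =>
    refine ⟨_, weight_mem_powSpan d h, ?_⟩
    rw [← H.e_f]
    simp
  | succ c ih =>
    obtain ⟨q, hq, hfq⟩ := ih
    obtain ⟨q', hq', hqe⟩ := H.exists_e_mul hq
    refine ⟨_, Submodule.add_mem _ (weight_mem_powSpan d h) hq', ?_⟩
    rw [pow_succ' e (c + 1), mul_assoc, hfq, mul_add, ← mul_assoc e q, hqe, ← mul_assoc e f,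
      sub_eq_iff_eq_add.1 H.e_f, add_mul, add_mul, mul_assoc q' e, ← pow_succ', mul_assoc f e]
    abel

/-- Passing `e` through `h ^ b` trades one power of `h` for one `e`; passing it through `f ^ a`
trades one `f` for a polynomial of degree at most one in `h`. Neither raises the total degree. -/
theorem CommRels.e_commutator_mem {d : ℕ} {e f h : A} (H : CommRels d e f h) {n : ℕ} {x : A}
    (hx : x ∈ monomialSpan e f h n) : e * x - x * e ∈ monomialSpan e f h n := by
  induction hx using Submodule.span_induction with
  | mem x hx =>
    obtain ⟨a, b, c, hn, rfl⟩ := hx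
    cases a with
    | zero =>
      have : e * (f ^ 0 * h ^ b * e ^ c) - f ^ 0 * h ^ b * e ^ c * e =
          f ^ 0 * ((h + 1) ^ b - h ^ b) * e ^ (c + 1) := by
        rw [pow_zero, one_mul, one_mul, ← mul_assoc, H.e_mul_pow, mul_assoc, mul_assoc (h ^ b),
          ← pow_succ, ← pow_succ', sub_mul]
      rw [this]
      exact mem_monomialSpan (add_one_pow_sub_pow_mem h b) (by omega)
    | succ a =>
      obtain ⟨q, hq, hfq⟩ := H.exists_e_mul_f_pow a
      have : e * (f ^ (a + 1) * h ^ b * e ^ c) - f ^ (a + 1) * h ^ b * e ^ c * e =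
          f ^ (a + 1) * ((h + 1) ^ b - h ^ b) * e ^ (c + 1) + f ^ a * (q * h ^ b) * e ^ c := by
        rw [← mul_assoc, ← mul_assoc, hfq, add_mul, mul_assoc _ e, H.e_mul_pow, add_mul,
          mul_assoc _ _ e, ← pow_succ, mul_sub, sub_mul, ← mul_assoc _ _ e, mul_assoc _ e,
          ← pow_succ', mul_assoc (f ^ a) q]
        abel
      rw [this]
      refine Submodule.add_mem _ (mem_monomialSpan (add_one_pow_sub_pow_mem h b) (by omega))
        (mem_monomialSpan (powSpan_mul_mem hq (pow_mem_powSpan h b.lt_succ_self)) (by omega))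
  | zero => simp
  | add x y _ _ hx hy =>
    rw [mul_add, add_mul, add_sub_add_comm]
    exact Submodule.add_mem _ hx hy
  | smul r x _ hx =>
    rw [mul_smul_comm, smul_mul_assoc, ← smul_sub]
    exact Submodule.smul_mem _ _ hx

theorem CommRels.f_commutator_mem {d : ℕ} {e f h : A} (H : CommRels d e f h) {n : ℕ} {x : A}
    (hx : x ∈ monomialSpan e f h n) : x * f - f * x ∈ monomialSpan e f h n := by
  induction hx using Submodule.span_induction with
  | mem x hx =>
    obtain ⟨a, b, c, hn, rfl⟩ := hx
    cases c with
    | zero =>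
      have : f ^ a * h ^ b * e ^ 0 * f - f * (f ^ a * h ^ b * e ^ 0) =
          f ^ (a + 1) * ((h + 1) ^ b - h ^ b) * e ^ 0 := by
        rw [pow_zero, mul_one, mul_one, mul_assoc, H.pow_mul_f, ← mul_assoc, ← mul_assoc,
          ← pow_succ, ← pow_succ', mul_sub]
      rw [this]
      exact mem_monomialSpan (add_one_pow_sub_pow_mem h b) (by omega)
    | succ c =>
      obtain ⟨q, hq, hfq⟩ := H.exists_e_pow_mul_f c
      have : f ^ a * h ^ b * e ^ (c + 1) * f - f * (f ^ a * h ^ b * e ^ (c + 1)) =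
          f ^ (a + 1) * ((h + 1) ^ b - h ^ b) * e ^ (c + 1) + f ^ a * (h ^ b * q) * e ^ c := by
        rw [mul_assoc _ _ f, hfq, mul_add, ← mul_assoc _ f, mul_assoc _ _ f, H.pow_mul_f,
          ← mul_assoc _ f, ← pow_succ, ← mul_assoc f, ← mul_assoc f, ← pow_succ', mul_sub, sub_mul,
          ← mul_assoc _ q, mul_assoc _ _ q]
        abel
      rw [this]
      refine Submodule.add_mem _ (mem_monomialSpan (add_one_pow_sub_pow_mem h b) (by omega))
        (mem_monomialSpan (powSpan_mul_mem (pow_mem_powSpan h b.lt_succ_self) hq) (by omega))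
  | zero => simp
  | add x y _ _ hx hy =>
    rw [mul_add, add_mul, add_sub_add_comm]
    exact Submodule.add_mem _ hx hy
  | smul r x _ hx =>
    rw [mul_smul_comm, smul_mul_assoc, ← smul_sub]
    exact Submodule.smul_mem _ _ hx

theorem mul_e_mem {e f h x : A} {n : ℕ} (hx : x ∈ monomialSpan e f h n) :
    x * e ∈ monomialSpan e f h (n + 1) := by
  induction hx using Submodule.span_induction with
  | mem x hx =>
    obtain ⟨a, b, c, hn, rfl⟩ := hx
    rw [mul_assoc, ← pow_succ]
    exact Submodule.subset_span ⟨a, b, c + 1, by omega, rfl⟩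
  | zero => simp
  | add x y _ _ hx hy => rw [add_mul]; exact Submodule.add_mem _ hx hy
  | smul r x _ hx => rw [smul_mul_assoc]; exact Submodule.smul_mem _ _ hx

theorem f_mul_mem {e f h x : A} {n : ℕ} (hx : x ∈ monomialSpan e f h n) :
    f * x ∈ monomialSpan e f h (n + 1) := by
  induction hx using Submodule.span_induction with
  | mem x hx =>
    obtain ⟨a, b, c, hn, rfl⟩ := hx
    rw [← mul_assoc, ← mul_assoc, ← pow_succ']
    exact Submodule.subset_span ⟨a + 1, b, c, by omega, rfl⟩
  | zero => simp
  | add x y _ _ hx hy => rw [mul_add]; exact Submodule.add_mem _ hx hy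
  | smul r x _ hx => rw [mul_smul_comm]; exact Submodule.smul_mem _ _ hx

theorem CommRels.e_mul_mem {d : ℕ} {e f h : A} (H : CommRels d e f h) {n : ℕ} {x : A}
    (hx : x ∈ monomialSpan e f h n) : e * x ∈ monomialSpan e f h (n + 1) := by
  simpa using Submodule.add_mem _
    (monomialSpan_mono e f h n.le_succ (H.e_commutator_mem hx)) (mul_e_mem hx)

theorem CommRels.exists_h_mul_f_pow {d : ℕ} {e f h : A} (H : CommRels d e f h) (a : ℕ) :
    ∃ q ∈ powSpan h 2, h * f ^ a = f ^ a * q := by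
  induction a with
  | zero => exact ⟨h, by simpa using pow_mem_powSpan h (show 1 < 2 by norm_num), by simp⟩
  | succ a ih =>
    obtain ⟨q, hq, hfq⟩ := ih
    obtain ⟨q', hq', hqf⟩ := H.exists_mul_f hq
    exact ⟨q', hq', by rw [pow_succ, ← mul_assoc, hfq, mul_assoc, hqf, mul_assoc]⟩

theorem CommRels.h_mul_mem {d : ℕ} {e f h : A} (H : CommRels d e f h) {n : ℕ} {x : A}
    (hx : x ∈ monomialSpan e f h n) : h * x ∈ monomialSpan e f h (n + 1) := by
  induction hx using Submodule.span_induction with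
  | mem x hx =>
    obtain ⟨a, b, c, hn, rfl⟩ := hx
    obtain ⟨q, hq, hfq⟩ := H.exists_h_mul_f_pow a
    rw [← mul_assoc, ← mul_assoc, hfq, mul_assoc _ q]
    exact mem_monomialSpan (powSpan_mul_mem hq (pow_mem_powSpan h b.lt_succ_self)) (by omega)
  | zero => simp
  | add x y _ _ hx hy => rw [mul_add]; exact Submodule.add_mem _ hx hy
  | smul r x _ hx => rw [mul_smul_comm]; exact Submodule.smul_mem _ _ hx

theorem pow_mem_monomialSpan (e f : A) {h : A} {n : ℕ} (hh : fallingProduct n h = 0) :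
    h ^ (n + 1) ∈ monomialSpan e f h n := by
  have := fallingProduct_sub_pow_mem h n
  rw [hh, zero_sub, Submodule.neg_mem_iff] at this
  simpa using mem_monomialSpan (e := e) (f := f) (a := 0) (c := 0) this (n := n) (by omega)

/-- Starting from `h ^ (n + 1)`, each commutator with `e` stays in the span and has leading term `(b
+ 1) • (h ^ b * e ^ (c + 1))`. -/
theorem CommRels.pow_mul_e_pow_mem {d : ℕ} {e f h : A} (H : CommRels d e f h) {n : ℕ}
    (hh : fallingProduct n h = 0) {b c : ℕ} (hbc : b + c = n + 1) :
    h ^ b * e ^ c ∈ monomialSpan e f h n := by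
  induction c generalizing b with
  | zero =>
    obtain rfl : b = n + 1 := by omega
    simpa using pow_mem_monomialSpan e f hh
  | succ c ih =>
    have h1 := H.e_commutator_mem (ih (b := b + 1) (by omega))
    have h2 := mem_monomialSpan (e := e) (f := f) (a := 0) (c := c + 1) (n := n)
      (add_one_pow_sub_mem h b) (by omega)
    have h3 : ((b : ℚ) + 1) • (h ^ b * e ^ (c + 1)) ∈ monomialSpan e f h n := by
      convert Submodule.sub_mem _ h1 h2 using 1
      rw [← mul_assoc, H.e_mul_pow, mul_assoc, mul_assoc _ _ e, ← pow_succ, ← pow_succ', pow_zero,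
        one_mul, sub_mul, sub_mul, smul_mul_assoc]
      abel
    exact (Submodule.smul_mem_iff _ (by positivity)).1 h3

theorem CommRels.monomial_mem {d : ℕ} {e f h : A} (H : CommRels d e f h) {n : ℕ}
    (hh : fallingProduct n h = 0) {a b c : ℕ} (habc : a + b + c = n + 1) :
    f ^ a * h ^ b * e ^ c ∈ monomialSpan e f h n := by
  induction a generalizing b c with
  | zero => simpa using H.pow_mul_e_pow_mem hh (show b + c = n + 1 by omega)
  | succ a ih =>
    have h1 := H.f_commutator_mem (ih (b := b + 1) (c := c) (by omega))
    have h2 := mem_monomialSpan (e := e) (f := f) (a := a + 1) (c := c) (n := n)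
      (add_one_pow_sub_mem h b) (by omega)
    have h3 : ((b : ℚ) + 1) • (f ^ (a + 1) * h ^ b * e ^ c) ∈ monomialSpan e f h n := by
      cases c with
      | zero =>
        convert Submodule.sub_mem _ h1 h2 using 1
        rw [pow_zero, mul_one, mul_one, mul_one, mul_assoc, H.pow_mul_f, ← mul_assoc, ← mul_assoc,
          ← pow_succ, ← pow_succ', mul_sub, mul_sub, mul_smul_comm]
        abel
      | succ c =>
        obtain ⟨q, hq, hfq⟩ := H.exists_e_pow_mul_f c
        -- The correction from moving `f` past `e ^ (c + 1)` may again have degree `n + 1`, but it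
        -- carries only `f ^ a`, so the induction hypothesis covers it.
        have h4 : ∀ p ∈ powSpan h (b + 2 + 1), f ^ a * p * e ^ c ∈ monomialSpan e f h n := by
          intro p hp
          induction hp using Submodule.span_induction with
          | mem x hx =>
            obtain ⟨k, hk, rfl⟩ := hx
            simp only [Set.mem_ofPred_eq] at hk
            rcases Nat.lt_or_ge (a + k + c) (n + 1) with hlt | hge
            · exact Submodule.subset_span ⟨a, k, c, by omega, rfl⟩
            · exact ih (by omega)
          | zero => simp
          | add x y _ _ hx hy => rw [mul_add, add_mul]; exact Submodule.add_mem _ hx hy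
          | smul r x _ hx =>
            rw [mul_smul_comm, smul_mul_assoc]; exact Submodule.smul_mem _ _ hx
        have h5 := h4 (h ^ (b + 1) * q)
          (powSpan_mul_mem (n := 1) (pow_mem_powSpan h (Nat.lt_succ_self _)) hq)
        convert Submodule.sub_mem _ (Submodule.sub_mem _ h1 h2) h5 using 1
        rw [mul_assoc _ _ f, hfq, mul_add, ← mul_assoc _ f, mul_assoc _ _ f, H.pow_mul_f,
          ← mul_assoc _ f, ← pow_succ, ← mul_assoc f, ← mul_assoc f, ← pow_succ', mul_sub, sub_mul,
          mul_sub, sub_mul, ← mul_assoc _ q, mul_assoc _ _ q, mul_smul_comm, smul_mul_assoc]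
        abel
    exact (Submodule.smul_mem_iff _ (by positivity)).1 h3

theorem CommRels.monomialSpan_succ_le {d : ℕ} {e f h : A} (H : CommRels d e f h) {n : ℕ}
    (hh : fallingProduct n h = 0) : monomialSpan e f h (n + 1) ≤ monomialSpan e f h n := by
  refine Submodule.span_le.2 ?_
  rintro _ ⟨a, b, c, hn, rfl⟩
  rcases Nat.lt_or_ge (a + b + c) (n + 1) with hlt | hge
  · exact Submodule.subset_span ⟨a, b, c, by omega, rfl⟩
  · exact H.monomial_mem hh (by omega)

end Straightening

/-! ### Spanning of the presented algebra -/

theorem gen_commRels (d : ℕ) : CommRels d (gen d .e) (gen d .f) (gen d .H₂) where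
  h_e := by simpa [gen] using RingQuot.mkAlgHom_rel ℚ (Rel.H₂_e (d := d))
  e_f := by simpa [gen, map_ofNat] using RingQuot.mkAlgHom_rel ℚ (Rel.e_f (d := d))
  h_f := by simpa [gen] using RingQuot.mkAlgHom_rel ℚ (Rel.H₂_f (d := d))

theorem map_fallingProduct {A B : Type*} [Ring A] [Ring B] [Algebra ℚ A] [Algebra ℚ B]
    (φ : A →ₐ[ℚ] B) (d : ℕ) (T : A) : φ (fallingProduct d T) = fallingProduct d (φ T) := by
  simp [fallingProduct, map_list_prod, Function.comp_def]

theorem fallingProduct_gen (d : ℕ) : fallingProduct d (gen d .H₂) = 0 := by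
  rw [gen, ← map_fallingProduct, RingQuot.mkAlgHom_rel ℚ (Rel.minpoly (d := d)), map_zero]

/-- Left multiplication by a generator raises the degree by at most one, and degree `d + 1`
collapses to degree `d`; so the span is a left ideal, and it contains `1`. -/
theorem monomialSpan_gen_eq_top (d : ℕ) :
    monomialSpan (gen d .e) (gen d .f) (gen d .H₂) d = ⊤ := by
  have H := gen_commRels d
  have hle := H.monomialSpan_succ_le (fallingProduct_gen d)
  have key : ∀ y : FreeAlgebra ℚ Gen, ∀ z ∈ monomialSpan (gen d .e) (gen d .f) (gen d .H₂) d,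
      RingQuot.mkAlgHom ℚ (Rel d) y * z ∈
        monomialSpan (gen d .e) (gen d .f) (gen d .H₂) d := by
    intro y
    induction y using FreeAlgebra.induction with
    | grade0 r =>
      intro z hz
      rw [AlgHom.commutes, ← Algebra.smul_def]
      exact Submodule.smul_mem _ _ hz
    | grade1 x =>
      intro z hz
      cases x with
      | e => exact hle (H.e_mul_mem hz)
      | f => exact hle (f_mul_mem hz)
      | H₂ => exact hle (H.h_mul_mem hz)
    | mul x y hx hy =>
      intro z hz
      rw [map_mul, mul_assoc]
      exact hx _ (hy _ hz)
    | add x y hx hy =>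
      intro z hz
      rw [map_add, add_mul]
      exact Submodule.add_mem _ (hx _ hz) (hy _ hz)
  rw [eq_top_iff]
  intro x _
  obtain ⟨y, rfl⟩ := RingQuot.mkAlgHom_surjective ℚ (Rel d) x
  simpa using key y 1 (Submodule.subset_span ⟨0, 0, 0, by omega, by simp⟩)

/-! ### The commutation relations on tensor space -/

/-- The operator acting by `x` on the `i`-th tensor factor. -/
def place (d : ℕ) (i : Fin d) : Module.End ℚ E →ₗ[ℚ] Module.End ℚ (TensorSpace d) :=
  (PiTensorProduct.mapMultilinear ℚ (fun _ : Fin d => E) (fun _ => E)).toLinearMap 1 i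

theorem place_apply (d : ℕ) (i : Fin d) (x : Module.End ℚ E) :
    place d i x = PiTensorProduct.map (Pi.mulSingle i x) := rfl

theorem place_one (d : ℕ) (i : Fin d) : place d i 1 = 1 := by
  rw [place_apply, Pi.mulSingle_one]
  exact PiTensorProduct.map_one

theorem place_mul_place (d : ℕ) (i : Fin d) (x y : Module.End ℚ E) :
    place d i x * place d i y = place d i (x * y) := by
  rw [place_apply, place_apply, place_apply, Pi.mulSingle_mul]
  exact (PiTensorProduct.map_mul _ _).symm

theorem place_commute (d : ℕ) {i j : Fin d} (hij : i ≠ j) (x y : Module.End ℚ E) :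
    place d i x * place d j y = place d j y * place d i x := by
  rw [place_apply, place_apply]
  refine (PiTensorProduct.map_mul _ _).symm.trans (Eq.trans ?_ (PiTensorProduct.map_mul _ _))
  exact congrArg PiTensorProduct.map
    (Pi.mulSingle_commute (f := fun _ : Fin d => Module.End ℚ E) hij x y).eq

theorem rho_eq_sum_place (d : ℕ) (X : Matrix (Fin 2) (Fin 2) ℚ) :
    rho d X = ∑ i, place d i (Matrix.toLin' X) := rfl

theorem rho_tprod (d : ℕ) (X : Matrix (Fin 2) (Fin 2) ℚ) (v : Fin d → E) :
    rho d X (PiTensorProduct.tprod ℚ v) =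
      ∑ i, PiTensorProduct.tprod ℚ (Function.update v i (X.mulVec (v i))) := by
  rw [rho, LinearMap.sum_apply]
  refine Finset.sum_congr rfl fun i _ => ?_
  rw [PiTensorProduct.map_tprod]
  congr 1
  ext1 j
  by_cases h : j = i
  · subst h; simp
  · simp [h]

theorem sum_mul_sum_commutator {R ι : Type*} [Ring R] [Fintype ι] (x y : ι → R)
    (hxy : ∀ i j, i ≠ j → x i * y j = y j * x i) :
    (∑ i, x i) * ∑ i, y i - (∑ i, y i) * ∑ i, x i = ∑ i, (x i * y i - y i * x i) := by
  rw [Finset.sum_mul_sum, Finset.sum_mul_sum, Finset.sum_comm (f := fun i j => y i * x j),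
    ← Finset.sum_sub_distrib]
  refine Finset.sum_congr rfl fun i _ => ?_
  rw [← Finset.sum_sub_distrib, Finset.sum_eq_single i]
  · intro j _ hj
    rw [hxy i j hj.symm, sub_self]
  · simp

theorem rho_commutator (d : ℕ) (X Y : Matrix (Fin 2) (Fin 2) ℚ) :
    rho d X * rho d Y - rho d Y * rho d X = rho d (X * Y - Y * X) := by
  refine (sum_mul_sum_commutator (fun i => place d i (Matrix.toLin' X))
    (fun i => place d i (Matrix.toLin' Y)) fun i j hij => place_commute d hij _ _).trans ?_
  rw [rho_eq_sum_place]
  refine Finset.sum_congr rfl fun i _ => ?_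
  rw [place_mul_place, place_mul_place, map_sub, Matrix.toLin'_mul, Matrix.toLin'_mul, map_sub]
  rfl

theorem rho_one (d : ℕ) : rho d 1 = (d : Module.End ℚ (TensorSpace d)) := by
  rw [rho_eq_sum_place]
  refine (Finset.sum_congr rfl fun i _ => ?_).trans ((Finset.sum_const 1).trans ?_)
  · rw [Matrix.toLin'_one]
    exact place_one d i
  simp

theorem rho_sub (d : ℕ) (X Y : Matrix (Fin 2) (Fin 2) ℚ) :
    rho d (X - Y) = rho d X - rho d Y := by
  simp [rho_eq_sum_place, Finset.sum_sub_distrib]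

theorem rho_commRels (d : ℕ) :
    CommRels d (rho d Gen.e.toMatrix) (rho d Gen.f.toMatrix) (rho d Gen.H₂.toMatrix) where
  h_e := by
    -- The right-hand side becomes `rho d (1 - 1 - X)`, so that only matrices remain to be compared.
    rw [rho_commutator, ← zero_sub (rho d _), ← sub_self (rho d 1), ← rho_sub, ← rho_sub]
    congr 1
    ext i j
    fin_cases i <;> fin_cases j <;> simp [Gen.toMatrix]
  e_f := by
    have h : rho d (Gen.e.toMatrix * Gen.f.toMatrix - Gen.f.toMatrix * Gen.e.toMatrix) =
        rho d 1 - rho d Gen.H₂.toMatrix - rho d Gen.H₂.toMatrix := by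
      rw [← rho_sub, ← rho_sub]
      congr 1
      ext i j
      fin_cases i <;> fin_cases j <;> simp [Gen.toMatrix]
    rw [rho_commutator, h, rho_one, two_mul]
    exact sub_sub (d : Module.End ℚ (TensorSpace d)) _ _
  h_f := by
    rw [rho_commutator]
    congr 1
    ext i j
    fin_cases i <;> fin_cases j <;> simp [Gen.toMatrix]

/-! ### Standard basis tensors and the action of the generators on them -/

/-- The standard basis vector of tensor space with second basis vector at the places in `J`. -/
def basisVec {d : ℕ} (J : Finset (Fin d)) : TensorSpace d :=
  PiTensorProduct.tprod ℚ fun i => (Pi.single (if i ∈ J then 1 else 0) 1 : E)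

/-- The coordinate form dual to `basisVec L`. -/
def coordForm {d : ℕ} (L : Finset (Fin d)) : TensorSpace d →ₗ[ℚ] ℚ :=
  PiTensorProduct.lift ((MultilinearMap.mkPiAlgebra ℚ (Fin d) ℚ).compLinearMap
    fun i => LinearMap.proj (if i ∈ L then 1 else 0))

theorem coordForm_tprod {d : ℕ} (L : Finset (Fin d)) (v : Fin d → E) :
    coordForm L (PiTensorProduct.tprod ℚ v) = ∏ i, v i (if i ∈ L then 1 else 0) := by
  simp [coordForm]

theorem coordForm_basisVec {d : ℕ} (L J : Finset (Fin d)) :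
    coordForm L (basisVec J) = if L = J then 1 else 0 := by
  rw [basisVec, coordForm_tprod]
  split_ifs with h
  · subst h
    simp
  · obtain ⟨i, hi⟩ : ∃ i, ¬ (i ∈ L ↔ i ∈ J) := by
      by_contra! hc
      exact h (Finset.ext hc)
    refine Finset.prod_eq_zero (Finset.mem_univ i) ?_
    by_cases h1 : i ∈ L <;> by_cases h2 : i ∈ J <;> simp_all

theorem end_ext_basisVec {d : ℕ} {M : Type*} [AddCommMonoid M] [Module ℚ M]
    {S T : TensorSpace d →ₗ[ℚ] M} (h : ∀ J, S (basisVec J) = T (basisVec J)) : S = T := by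
  refine (Basis.piTensorProduct fun _ : Fin d => Pi.basisFun ℚ (Fin 2)).ext fun p => ?_
  have hp : Basis.piTensorProduct (fun _ : Fin d => Pi.basisFun ℚ (Fin 2)) p =
      basisVec (Finset.univ.filter fun i => p i = 1) := by
    rw [Basis.piTensorProduct_apply, basisVec]
    congr 1
    ext1 i
    simp only [Pi.basisFun_apply, Finset.mem_filter, Finset.mem_univ, true_and]
    congr 1
    split_ifs <;> omega
  rw [hp]
  exact h _

theorem rho_H₂_basisVec {d : ℕ} (J : Finset (Fin d)) :
    rho d Gen.H₂.toMatrix (basisVec J) = (J.card : ℚ) • basisVec J := by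
  rw [basisVec, rho_tprod]
  have : ∀ i : Fin d, PiTensorProduct.tprod ℚ (Function.update
      (fun i => (Pi.single (if i ∈ J then 1 else 0) 1 : E)) i
      (Gen.H₂.toMatrix.mulVec (Pi.single (if i ∈ J then 1 else 0) 1))) =
      if i ∈ J then basisVec J else 0 := by
    intro i
    split_ifs with hi
    · rw [basisVec]
      congr 1
      rw [Function.update_eq_self_iff]
      ext k
      fin_cases k <;> simp [hi, Gen.toMatrix]
    · refine MultilinearMap.map_coord_zero _ i ?_
      ext k
      fin_cases k <;> simp [Gen.toMatrix]
  rw [Finset.sum_congr rfl fun i _ => this i]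
  simp [basisVec, Nat.cast_smul_eq_nsmul]

theorem rho_e_basisVec {d : ℕ} (J : Finset (Fin d)) :
    rho d Gen.e.toMatrix (basisVec J) = ∑ i ∈ J, basisVec (J.erase i) := by
  rw [basisVec, rho_tprod]
  have : ∀ i : Fin d, PiTensorProduct.tprod ℚ (Function.update
      (fun i => (Pi.single (if i ∈ J then 1 else 0) 1 : E)) i
      (Gen.e.toMatrix.mulVec (Pi.single (if i ∈ J then 1 else 0) 1))) =
      if i ∈ J then basisVec (J.erase i) else 0 := by
    intro i
    split_ifs with hi
    · rw [basisVec]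
      congr 1
      ext1 j
      by_cases hj : j = i
      · subst hj
        ext k
        fin_cases k <;> simp [Gen.toMatrix]
      · simp [hj]
    · refine MultilinearMap.map_coord_zero _ i ?_
      ext k
      fin_cases k <;> simp [Gen.toMatrix]
  rw [Finset.sum_congr rfl fun i _ => this i]
  simp

/-- The transpose of `f` lowers `L` just as `e` lowers `J`, so powers of `f` can be peeled off on
the dual side. -/
theorem coordForm_rho_f {d : ℕ} (L : Finset (Fin d)) (x : TensorSpace d) :
    coordForm L (rho d Gen.f.toMatrix x) = ∑ i ∈ L, coordForm (L.erase i) x := by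
  have : coordForm L ∘ₗ rho d Gen.f.toMatrix = ∑ i ∈ L, coordForm (L.erase i) := by
    refine PiTensorProduct.ext (MultilinearMap.ext fun v => ?_)
    simp only [LinearMap.compMultilinearMap_apply, LinearMap.comp_apply, rho_tprod, map_sum,
      LinearMap.sum_apply, coordForm_tprod]
    rw [← Finset.sum_subset (Finset.subset_univ L)]
    · refine Finset.sum_congr rfl fun i hi => Finset.prod_congr rfl fun j _ => ?_
      by_cases hj : j = i
      · subst hj
        simp [hi, Gen.toMatrix, dotProduct]
      · simp [hj]
    · intro i _ hi
      refine Finset.prod_eq_zero (Finset.mem_univ i) ?_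
      simp [hi, Gen.toMatrix, dotProduct]
  rw [← LinearMap.comp_apply, this, LinearMap.sum_apply]

theorem rho_H₂_pow_basisVec {d : ℕ} (J : Finset (Fin d)) (b : ℕ) :
    (rho d Gen.H₂.toMatrix ^ b) (basisVec J) = (J.card : ℚ) ^ b • basisVec J := by
  induction b with
  | zero => simp
  | succ b ih =>
    rw [pow_succ', Module.End.mul_apply, ih, map_smul, rho_H₂_basisVec, smul_smul, pow_succ]

/-- `H₂` is diagonal with eigenvalues `J.card`, all among `0, …, d`. -/
theorem fallingProduct_rho (d : ℕ) : fallingProduct d (rho d Gen.H₂.toMatrix) = 0 := by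
  refine end_ext_basisVec fun J => ?_
  have key : ∀ l : List ℕ, (l.map fun k : ℕ =>
      rho d Gen.H₂.toMatrix - (k : Module.End ℚ (TensorSpace d))).prod (basisVec J) =
      (l.map fun k : ℕ => (J.card : ℚ) - k).prod • basisVec J := by
    intro l
    induction l with
    | nil => simp
    | cons k l ih =>
      rw [List.map_cons, List.prod_cons, Module.End.mul_apply, ih, map_smul, LinearMap.sub_apply,
        rho_H₂_basisVec, Module.End.natCast_apply, ← Nat.cast_smul_eq_nsmul ℚ,
        List.map_cons, List.prod_cons, mul_comm, mul_smul]
      exact congrArg _ (sub_smul (J.card : ℚ) (k : ℚ) (basisVec J)).symm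
  rw [fallingProduct, key, LinearMap.zero_apply]
  have : (0 : ℚ) ∈ (List.range (d + 1)).map fun k : ℕ => (J.card : ℚ) - k := by
    refine List.mem_map.2 ⟨J.card, List.mem_range.2 ?_, sub_self _⟩
    have := J.card_le_univ
    rw [Fintype.card_fin] at this
    omega
  rw [List.prod_eq_zero this, zero_smul]

/-- The representation of the presented algebra on tensor space. -/
def toEnd (d : ℕ) : Presented d →ₐ[ℚ] Module.End ℚ (TensorSpace d) :=
  RingQuot.liftAlgHom ℚ ⟨FreeAlgebra.lift ℚ fun x => rho d x.toMatrix, by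
    intro x y hxy
    cases hxy with
    | H₂_e => simpa using (rho_commRels d).h_e
    | e_f => simpa [map_ofNat] using (rho_commRels d).e_f
    | H₂_f => simpa using (rho_commRels d).h_f
    | minpoly =>
      refine (map_fallingProduct (FreeAlgebra.lift ℚ fun x : Gen => rho d x.toMatrix) d _).trans ?_
      rw [FreeAlgebra.lift_ι_apply, fallingProduct_rho, map_zero]⟩

theorem toEnd_gen (d : ℕ) (x : Gen) : toEnd d (gen d x) = rho d x.toMatrix := by
  simp [toEnd, gen]

/-! ### Matrix coefficients and linear independence -/

theorem coordForm_H₂_pow_mul_e_pow {d : ℕ} (b c : ℕ) (L J : Finset (Fin d))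
    (hc : c ≤ (L \ J).card + (J \ L).card) :
    coordForm L ((rho d Gen.H₂.toMatrix ^ b * rho d Gen.e.toMatrix ^ c) (basisVec J)) =
      if 0 = (L \ J).card ∧ c = (J \ L).card then (c.factorial : ℚ) * ((L ∩ J).card : ℚ) ^ b
      else 0 := by
  induction c generalizing J with
  | zero =>
    rw [pow_zero, mul_one, rho_H₂_pow_basisVec, map_smul, coordForm_basisVec]
    have : (0 = (L \ J).card ∧ 0 = (J \ L).card) ↔ L = J := by
      rw [eq_comm, Finset.card_eq_zero, eq_comm (a := 0), Finset.card_eq_zero,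
        Finset.sdiff_eq_empty_iff_subset, Finset.sdiff_eq_empty_iff_subset]
      exact ⟨fun h => h.1.antisymm h.2, fun h => h ▸ ⟨subset_rfl, subset_rfl⟩⟩
    simp only [this]
    split_ifs with h
    · subst h; simp
    · simp
  | succ c ih =>
    rw [pow_succ, ← mul_assoc, Module.End.mul_apply, rho_e_basisVec, map_sum, map_sum]
    have hterm : ∀ i ∈ J, coordForm L ((rho d Gen.H₂.toMatrix ^ b * rho d Gen.e.toMatrix ^ c)
        (basisVec (J.erase i))) = if i ∉ L then
          (if 0 = (L \ J).card ∧ c + 1 = (J \ L).card then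
            (c.factorial : ℚ) * ((L ∩ J).card : ℚ) ^ b else 0) else 0 := by
      intro i hi
      by_cases hiL : i ∈ L
      · have h1 : L \ J.erase i = insert i (L \ J) := by
          ext j; by_cases hj : j = i <;> simp_all
        have h2 : J.erase i \ L = J \ L := by
          ext j; by_cases hj : j = i <;> simp_all
        have h3 : (insert i (L \ J)).card = (L \ J).card + 1 :=
          Finset.card_insert_of_notMem (by simp [hi])
        rw [ih (J.erase i) (by rw [h1, h2, h3]; omega), h1, h2, h3, if_neg (by omega),
          if_neg (by simpa using hiL)]
      · have h1 : L \ J.erase i = L \ J := by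
          ext j; by_cases hj : j = i <;> simp_all
        have h2 : J.erase i \ L = (J \ L).erase i := by
          ext j; by_cases hj : j = i <;> simp_all
        have h3 : ((J \ L).erase i).card + 1 = (J \ L).card :=
          Finset.card_erase_add_one (by simp [hi, hiL])
        have h4 : L ∩ J.erase i = L ∩ J := by
          ext j; by_cases hj : j = i <;> simp_all
        rw [ih (J.erase i) (by rw [h1, h2]; omega), h1, h2, h4, if_pos hiL, ← h3]
        simp only [add_left_inj]
    rw [Finset.sum_congr rfl hterm, ← Finset.sum_filter, Finset.sum_const,
      Finset.filter_notMem_eq_sdiff]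
    split_ifs with h
    · rw [← h.2, nsmul_eq_mul, Nat.factorial_succ]
      push_cast
      ring
    · simp

/-- The `a + c` single-place changes must undo the whole symmetric difference of `L` and `J`, so
none can be wasted: `e` removes `J \ L` and `f` adds `L \ J`, in `c!` and `a!` orders, and in
between `H₂` sees `L ∩ J`. -/
theorem coordForm_monomial {d : ℕ} (a b c : ℕ) (L J : Finset (Fin d))
    (hc : a + c ≤ (L \ J).card + (J \ L).card) :
    coordForm L ((rho d Gen.f.toMatrix ^ a * rho d Gen.H₂.toMatrix ^ b *
        rho d Gen.e.toMatrix ^ c) (basisVec J)) =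
      if a = (L \ J).card ∧ c = (J \ L).card then
        (a.factorial : ℚ) * (c.factorial : ℚ) * ((L ∩ J).card : ℚ) ^ b
      else 0 := by
  induction a generalizing L with
  | zero =>
    rw [pow_zero, one_mul, coordForm_H₂_pow_mul_e_pow _ _ _ _ (by omega)]
    simp
  | succ a ih =>
    rw [pow_succ', mul_assoc, mul_assoc, Module.End.mul_apply, coordForm_rho_f]
    simp only [← mul_assoc]
    have hterm : ∀ i ∈ L, coordForm (L.erase i) ((rho d Gen.f.toMatrix ^ a *
        rho d Gen.H₂.toMatrix ^ b * rho d Gen.e.toMatrix ^ c) (basisVec J)) = if i ∉ J then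
          (if a + 1 = (L \ J).card ∧ c = (J \ L).card then
            (a.factorial : ℚ) * (c.factorial : ℚ) * ((L ∩ J).card : ℚ) ^ b else 0) else 0 := by
      intro i hi
      by_cases hiJ : i ∈ J
      · have h1 : J \ L.erase i = insert i (J \ L) := by
          ext j; by_cases hj : j = i <;> simp_all
        have h2 : L.erase i \ J = L \ J := by
          ext j; by_cases hj : j = i <;> simp_all
        have h3 : (insert i (J \ L)).card = (J \ L).card + 1 :=
          Finset.card_insert_of_notMem (by simp [hi])
        rw [ih (L.erase i) (by rw [h1, h2, h3]; omega), h1, h2, h3, if_neg (by omega),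
          if_neg (by simpa using hiJ)]
      · have h1 : J \ L.erase i = J \ L := by
          ext j; by_cases hj : j = i <;> simp_all
        have h2 : L.erase i \ J = (L \ J).erase i := by
          ext j; by_cases hj : j = i <;> simp_all
        have h3 : ((L \ J).erase i).card + 1 = (L \ J).card :=
          Finset.card_erase_add_one (by simp [hi, hiJ])
        have h4 : L.erase i ∩ J = L ∩ J := by
          ext j; by_cases hj : j = i <;> simp_all
        rw [ih (L.erase i) (by rw [h1, h2]; omega), h1, h2, h4, if_pos hiJ, ← h3]
        simp only [add_left_inj]
    rw [Finset.sum_congr rfl hterm, ← Finset.sum_filter, Finset.sum_const,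
      Finset.filter_notMem_eq_sdiff]
    split_ifs with h
    · rw [← h.1, nsmul_eq_mul, Nat.factorial_succ]
      push_cast
      ring
    · simp

theorem exists_finset_pair {d p q m : ℕ} (h : p + q + m ≤ d) :
    ∃ L J : Finset (Fin d), (L \ J).card = p ∧ (J \ L).card = q ∧ (L ∩ J).card = m := by
  obtain ⟨V, -, hV⟩ := Finset.exists_subset_card_eq (s := (Finset.univ : Finset (Fin d)))
    (n := p + q + m) (by simpa using h)
  obtain ⟨P, hP, hPc⟩ := Finset.exists_subset_card_eq (s := V) (n := p) (by omega)
  obtain ⟨Q, hQ, hQc⟩ := Finset.exists_subset_card_eq (s := V \ P) (n := q)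
    (by rw [Finset.card_sdiff_of_subset hP]; omega)
  have hQV : Q ⊆ V := hQ.trans Finset.sdiff_subset
  have hPQ : ∀ i ∈ Q, i ∉ P := fun i hi => (Finset.mem_sdiff.1 (hQ hi)).2
  -- With `P` and `Q` disjoint in `V`, the two differences are `P` and `Q`, and the intersection is
  -- the rest of `V`.
  refine ⟨V \ Q, V \ P, ?_, ?_, ?_⟩
  · rw [← hPc]
    congr 1
    ext i
    have h1 := hPQ i
    have h2 := @hP i
    simp only [Finset.mem_sdiff]
    tauto
  · rw [← hQc]
    congr 1
    ext i
    have h1 := hPQ i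
    have h2 := @hQV i
    simp only [Finset.mem_sdiff]
    tauto
  · have : (V \ Q) ∩ (V \ P) = (V \ P) \ Q := by
      ext i
      simp only [Finset.mem_sdiff, Finset.mem_inter]
      tauto
    rw [this, Finset.card_sdiff_of_subset hQ, Finset.card_sdiff_of_subset hP]
    omega

theorem rho_monomials_independent (d : ℕ) (s : Finset (Exponent d)) (g : Exponent d → ℚ)
    (hg : ∑ t ∈ s, g t • (rho d Gen.f.toMatrix ^ t.1.1 * rho d Gen.H₂.toMatrix ^ t.1.2.1 *
      rho d Gen.e.toMatrix ^ t.1.2.2) = 0) : ∀ t ∈ s, g t = 0 := by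
  by_contra! hne
  obtain ⟨t₁, ht₁, hgt₁⟩ := hne
  -- Maximality of `a + c` is exactly the degree hypothesis of `coordForm_monomial` for every term
  -- with nonzero coefficient.
  obtain ⟨t₀, ht₀, hmax⟩ := Finset.exists_max_image (s.filter fun t => g t ≠ 0)
    (fun t => t.1.1 + t.1.2.2) ⟨t₁, Finset.mem_filter.2 ⟨ht₁, hgt₁⟩⟩
  obtain ⟨ht₀s, hgt₀⟩ := Finset.mem_filter.1 ht₀
  obtain ⟨⟨p, b₀, q⟩, hle⟩ := t₀
  simp only at hle hmax
  set u := s.filter fun t => t.1.1 = p ∧ t.1.2.2 = q with hu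
  let P : Polynomial ℚ := ∑ t ∈ u, Polynomial.C (g t) * Polynomial.X ^ t.1.2.1
  have hroot : ∀ m : Fin (d - p - q + 1), P.eval ((m : ℕ) : ℚ) = 0 := by
    intro m
    have hm := m.2
    obtain ⟨L, J, hL, hJ, hLJ⟩ := exists_finset_pair (d := d) (p := p) (q := q) (m := m) (by omega)
    have h0 := congrArg (fun T : Module.End ℚ (TensorSpace d) => coordForm L (T (basisVec J))) hg
    simp only [LinearMap.sum_apply, LinearMap.smul_apply, map_sum, map_smul, LinearMap.zero_apply,
      map_zero] at h0
    have hterm : ∀ t ∈ s, g t • coordForm L ((rho d Gen.f.toMatrix ^ t.1.1 *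
        rho d Gen.H₂.toMatrix ^ t.1.2.1 * rho d Gen.e.toMatrix ^ t.1.2.2) (basisVec J)) =
        if t.1.1 = p ∧ t.1.2.2 = q then
          ((p.factorial : ℚ) * q.factorial) * (g t * (m : ℚ) ^ t.1.2.1) else 0 := by
      intro t ht
      by_cases hgt : g t = 0
      · simp [hgt]
      · have := hmax t (Finset.mem_filter.2 ⟨ht, hgt⟩)
        rw [coordForm_monomial _ _ _ _ _ (by rw [hL, hJ]; exact this), hL, hJ, hLJ]
        split_ifs with h
        · rw [h.1, h.2, smul_eq_mul]
          ring
        · simp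
    rw [Finset.sum_congr rfl hterm, ← Finset.sum_filter, ← Finset.mul_sum] at h0
    have hpq : ((p.factorial : ℚ) * q.factorial) ≠ 0 := by positivity
    simpa [P, Polynomial.eval_finsetSum] using (mul_eq_zero.1 h0).resolve_left hpq
  -- Since `p + b + q ≤ d`, the degree is at most `d - p - q`, one less than the number of values
  -- `m` available for the size of `L ∩ J`.
  have hdeg : P.natDegree < Fintype.card (Fin (d - p - q + 1)) := by
    rw [Fintype.card_fin, Nat.lt_succ_iff]
    refine Polynomial.natDegree_sum_le_of_forall_le _ _ fun t ht => ?_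
    have h1 := (Finset.mem_filter.1 ht).2
    have h2 := t.2
    exact (Polynomial.natDegree_C_mul_X_pow_le _ _).trans (by omega)
  have hP : P = 0 := Polynomial.eq_zero_of_natDegree_lt_card_of_eval_eq_zero P
    (f := fun m : Fin (d - p - q + 1) => ((m : ℕ) : ℚ))
    (fun x y hxy => Fin.ext (Nat.cast_injective (R := ℚ) hxy)) hroot hdeg
  apply hgt₀
  have hcoeff := congrArg (fun R : Polynomial ℚ => R.coeff b₀) hP
  simp only [P, Polynomial.finsetSum_coeff, Polynomial.coeff_C_mul_X_pow,
    Polynomial.coeff_zero] at hcoeff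
  rw [Finset.sum_eq_single ⟨(p, b₀, q), hle⟩] at hcoeff
  · simpa using hcoeff
  · rintro ⟨⟨a, b, c⟩, habc⟩ ht hne
    obtain ⟨-, rfl, rfl⟩ := Finset.mem_filter.1 ht
    refine if_neg ?_
    rintro rfl
    exact hne rfl
  · intro h
    exact absurd (Finset.mem_filter.2 ⟨ht₀s, rfl, rfl⟩) h

/-! ### The Lie algebra generators act inside the Schur algebra -/

theorem map_add_smul (d : ℕ) (x : Module.End ℚ E) (t : ℚ) :
    (PiTensorProduct.map fun _ : Fin d => 1 + t • x) =
      ∑ s : Finset (Fin d), t ^ s.card •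
        PiTensorProduct.map (s.piecewise (fun _ => x) fun _ => (1 : Module.End ℚ E)) := by
  have h := (PiTensorProduct.mapMultilinear ℚ (fun _ : Fin d => E) (fun _ => E)).map_add_univ
    (fun _ => t • x) (fun _ => 1)
  have h2 : ((fun _ => t • x) + fun _ => 1 : Fin d → Module.End ℚ E) = fun _ => 1 + t • x := by
    ext1 i
    exact add_comm _ _
  rw [h2] at h
  refine h.trans (Finset.sum_congr rfl fun s _ => ?_)
  have h3 := (PiTensorProduct.mapMultilinear ℚ (fun _ : Fin d => E)
    (fun _ => E)).map_piecewise_smul (fun _ => t) (s.piecewise (fun _ => x) fun _ => 1) s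
  rw [Finset.prod_const] at h3
  refine Eq.trans ?_ h3
  congr 1
  ext1 i
  by_cases hi : i ∈ s <;> simp [hi]

/-- Otherwise a linear form `l` kills the Schur algebra but not `rho d X`. Then `l (sigma d (1 + n •
X))` is a polynomial in `n` vanishing at every natural number, hence zero, although its linear
coefficient is `l (rho d X)`. -/
theorem rho_mem_schurAlgebra (d : ℕ) (X : Matrix (Fin 2) (Fin 2) ℚ)
    (hX : ∀ n : ℕ, (1 + (n : ℚ) • X).det ≠ 0) : rho d X ∈ schurAlgebra d := by
  by_contra hnot
  obtain ⟨l, hl, hle⟩ := Submodule.exists_le_ker_of_notMem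
    (p := Subalgebra.toSubmodule (schurAlgebra d)) (v := rho d X) hnot
  let M : Finset (Fin d) → Module.End ℚ (TensorSpace d) := fun s =>
    PiTensorProduct.map (s.piecewise (fun _ => Matrix.toLin' X) fun _ => (1 : Module.End ℚ E))
  let P : Polynomial ℚ := ∑ s, Polynomial.C (l (M s)) * Polynomial.X ^ s.card
  have hroot : ∀ n : ℕ, P.eval (n : ℚ) = 0 := by
    intro n
    let g := Matrix.GeneralLinearGroup.mkOfDetNeZero _ (hX n)
    have hg : sigma d g ∈ schurAlgebra d :=
      ⟨MonoidAlgebra.of ℚ _ g, (sigma d).asAlgebraHom_of g⟩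
    have h0 : l (sigma d g) = 0 := hle hg
    have hs : sigma d g = ∑ s, (n : ℚ) ^ s.card • M s := by
      rw [← map_add_smul]
      change PiTensorProduct.map (fun _ => Matrix.toLin' (1 + (n : ℚ) • X)) = _
      rw [map_add, map_smul, Matrix.toLin'_one]
      rfl
    rw [hs, map_sum] at h0
    simp only [map_smul, smul_eq_mul] at h0
    simp only [P, Polynomial.eval_finsetSum, Polynomial.eval_mul, Polynomial.eval_C,
      Polynomial.eval_pow, Polynomial.eval_X]
    rw [← h0]
    exact Finset.sum_congr rfl fun s _ => mul_comm _ _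
  have hP : P = 0 := Polynomial.eq_zero_of_infinite_isRoot P
    ((Set.infinite_range_of_injective (Nat.cast_injective (R := ℚ))).mono
      (by rintro _ ⟨n, rfl⟩; exact hroot n))
  apply hl
  have hcoeff := congrArg (fun R : Polynomial ℚ => R.coeff 1) hP
  simp only [P, Polynomial.finsetSum_coeff, Polynomial.coeff_C_mul_X_pow,
    Polynomial.coeff_zero] at hcoeff
  rw [← Finset.sum_filter] at hcoeff
  have hfil : (Finset.univ.filter fun s : Finset (Fin d) => 1 = s.card) =
      Finset.univ.map ⟨singleton, Finset.singleton_injective⟩ := by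
    rw [← Finset.powersetCard_one]
    ext s
    simp [Finset.mem_powersetCard, eq_comm]
  rw [hfil, Finset.sum_map] at hcoeff
  rw [rho, map_sum, ← hcoeff]
  refine Finset.sum_congr rfl fun i _ => ?_
  simp only [M, Function.Embedding.coeFn_mk, Finset.piecewise_singleton]
  rfl

/-! ### Upper bound for the dimension of the Schur algebra -/

instance finite_exponent (d : ℕ) : Finite (Exponent d) :=
  Finite.of_injective
    (fun t : Exponent d => ((⟨t.1.1, by have := t.2; omega⟩, ⟨t.1.2.1, by have := t.2; omega⟩,
      ⟨t.1.2.2, by have := t.2; omega⟩) : Fin (d + 1) × Fin (d + 1) × Fin (d + 1)))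
    (by
      rintro ⟨⟨a, b, c⟩, h⟩ ⟨⟨a', b', c'⟩, h'⟩ heq
      simpa using heq)

/-- The number of places where a sequence of matrix positions takes the value `x`. -/
def positionCount {d : ℕ} (r : Fin d → Fin 2 × Fin 2) (x : Fin 2 × Fin 2) : ℕ :=
  (Finset.univ.filter fun k => r k = x).card

theorem sum_positionCount {d : ℕ} (r : Fin d → Fin 2 × Fin 2) :
    positionCount r (0, 0) + positionCount r (0, 1) +
      (positionCount r (1, 0) + positionCount r (1, 1)) = d := by
  have h := Finset.card_eq_sum_card_fiberwise (s := Finset.univ) (t := Finset.univ) (f := r)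
    (fun _ _ => Finset.mem_coe.2 (Finset.mem_univ _))
  rw [Fintype.sum_prod_type, Fin.sum_univ_two, Fin.sum_univ_two, Fin.sum_univ_two, Finset.card_univ,
    Fintype.card_fin] at h
  exact h.symm

/-- The content of a sequence of matrix positions. -/
def content {d : ℕ} (r : Fin d → Fin 2 × Fin 2) : Exponent d :=
  ⟨(positionCount r (1, 0), positionCount r (1, 1), positionCount r (0, 1)), by
    have := sum_positionCount r
    simp only
    omega⟩

/-- The sum of the tensor products of matrix units with a given content. -/
def symmetrizedUnit (d : ℕ) (t : Exponent d) : Module.End ℚ (TensorSpace d) :=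
  ∑ r : Fin d → Fin 2 × Fin 2 with content r = t,
    PiTensorProduct.map fun k => Matrix.toLin' (Matrix.single (r k).1 (r k).2 (1 : ℚ))

theorem prod_entries {d : ℕ} (F : Fin 2 × Fin 2 → ℚ) (r : Fin d → Fin 2 × Fin 2) :
    ∏ k, F (r k) = F (1, 0) ^ (content r).1.1 * F (1, 1) ^ (content r).1.2.1 *
      F (0, 1) ^ (content r).1.2.2 *
      F (0, 0) ^ (d - (content r).1.1 - (content r).1.2.1 - (content r).1.2.2) := by
  have h := sum_positionCount r
  have h0 : d - (content r).1.1 - (content r).1.2.1 - (content r).1.2.2 =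
      positionCount r (0, 0) := by
    simp only [content]
    omega
  rw [h0, ← Finset.prod_fiberwise' Finset.univ r F]
  simp only [Finset.prod_const, Fintype.prod_prod_type, Fin.prod_univ_two]
  simp only [content, positionCount]
  ring

/-- Expanding the tensor power of `g` in matrix units, the coefficient of a sequence of positions is
a product of entries of `g`, which depends only on its content; terms of equal content can be
grouped. -/
theorem sigma_mem_span (d : ℕ) (g : GL (Fin 2) ℚ) :
    sigma d g ∈ Submodule.span ℚ (Set.range (symmetrizedUnit d)) := by
  cases nonempty_fintype (Exponent d)
  let F : Fin 2 × Fin 2 → ℚ := fun x => (g : Matrix (Fin 2) (Fin 2) ℚ) x.1 x.2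
  let u : Fin 2 × Fin 2 → Module.End ℚ E := fun x => Matrix.toLin' (Matrix.single x.1 x.2 (1 : ℚ))
  have hg : Matrix.toLin' (g : Matrix (Fin 2) (Fin 2) ℚ) = ∑ x, F x • u x := by
    conv_lhs => rw [Matrix.matrix_eq_sum_single (g : Matrix (Fin 2) (Fin 2) ℚ)]
    rw [Fintype.sum_prod_type]
    simp only [map_sum, F, u, ← map_smul, Matrix.smul_single, smul_eq_mul, mul_one]
  have h1 : sigma d g = ∑ r : Fin d → Fin 2 × Fin 2, (∏ k, F (r k)) •
      PiTensorProduct.map fun k => u (r k) := by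
    change PiTensorProduct.map (fun _ => Matrix.toLin' (g : Matrix (Fin 2) (Fin 2) ℚ)) = _
    rw [hg]
    refine ((PiTensorProduct.mapMultilinear ℚ (fun _ : Fin d => E) (fun _ => E)).map_sum
      (fun _ x => F x • u x)).trans (Finset.sum_congr rfl fun r _ => ?_)
    exact (PiTensorProduct.mapMultilinear ℚ (fun _ : Fin d => E) (fun _ => E)).map_smul_univ
      (fun k => F (r k)) fun k => u (r k)
  rw [h1, ← Finset.sum_fiberwise Finset.univ content]
  refine Submodule.sum_mem _ fun t _ => ?_
  have h2 : ∑ r : Fin d → Fin 2 × Fin 2 with content r = t, (∏ k, F (r k)) •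
      (PiTensorProduct.map fun k => u (r k)) =
      (F (1, 0) ^ t.1.1 * F (1, 1) ^ t.1.2.1 * F (0, 1) ^ t.1.2.2 *
        F (0, 0) ^ (d - t.1.1 - t.1.2.1 - t.1.2.2)) • symmetrizedUnit d t := by
    rw [symmetrizedUnit, Finset.smul_sum]
    refine Finset.sum_congr rfl fun r hr => ?_
    rw [prod_entries, (Finset.mem_filter.1 hr).2]
  rw [h2]
  exact Submodule.smul_mem _ _ (Submodule.subset_span ⟨t, rfl⟩)

theorem schurAlgebra_le_span (d : ℕ) : Subalgebra.toSubmodule (schurAlgebra d) ≤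
    Submodule.span ℚ (Set.range (symmetrizedUnit d)) := by
  rintro _ ⟨x, rfl⟩
  change (sigma d).asAlgebraHom x ∈ _
  induction x using MonoidAlgebra.induction_on with
  | of g =>
    rw [Representation.asAlgebraHom_of]
    exact sigma_mem_span d g
  | add x y hx hy =>
    rw [map_add]
    exact Submodule.add_mem _ hx hy
  | smul r x hx =>
    rw [map_smul]
    exact Submodule.smul_mem _ _ hx

/-! ### The monomial basis and the isomorphism -/

theorem toEnd_range_le (d : ℕ) : (toEnd d).range ≤ schurAlgebra d := by
  have hgen : ∀ x : Gen, rho d x.toMatrix ∈ schurAlgebra d := by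
    intro x
    refine rho_mem_schurAlgebra d _ fun n => ?_
    have hn : (1 + n : ℚ) ≠ 0 := by positivity
    -- The determinant is `1` for `e` and `f`, and `1 + n` for `H₂`.
    cases x <;> simp [Gen.toMatrix, Matrix.det_fin_two, hn]
  rintro _ ⟨x, rfl⟩
  change toEnd d x ∈ _
  obtain ⟨y, rfl⟩ := RingQuot.mkAlgHom_surjective ℚ (Rel d) x
  induction y using FreeAlgebra.induction with
  | grade0 r =>
    rw [AlgHom.commutes, AlgHom.commutes]
    exact Subalgebra.algebraMap_mem _ _
  | grade1 x =>
    rw [← gen, toEnd_gen]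
    exact hgen x
  | mul x y hx hy =>
    rw [map_mul, map_mul]
    exact Subalgebra.mul_mem _ hx hy
  | add x y hx hy =>
    rw [map_add, map_add]
    exact Subalgebra.add_mem _ hx hy

/-- The monomial `f ^ a * H₂ ^ b * e ^ c` in the presented algebra. -/
def monomial (d : ℕ) (t : Exponent d) : Presented d :=
  gen d .f ^ t.1.1 * gen d .H₂ ^ t.1.2.1 * gen d .e ^ t.1.2.2

/-- Assuming only that the image vanishes serves twice: for independence of the monomials and for
injectivity of `toEnd`. -/
theorem eq_zero_of_toEnd_sum_monomial (d : ℕ) (s : Finset (Exponent d)) (g : Exponent d → ℚ)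
    (hg : toEnd d (∑ t ∈ s, g t • monomial d t) = 0) : ∀ t ∈ s, g t = 0 := by
  refine rho_monomials_independent d s g ?_
  rw [← hg, map_sum]
  refine Finset.sum_congr rfl fun t _ => ?_
  rw [map_smul, monomial, map_mul, map_mul, map_pow, map_pow, map_pow, toEnd_gen, toEnd_gen,
    toEnd_gen]

theorem linearIndependent_monomial (d : ℕ) : LinearIndependent ℚ (monomial d) :=
  linearIndependent_iff'.2 fun s g hg =>
    eq_zero_of_toEnd_sum_monomial d s g (by rw [hg, map_zero])

/-- The basis of the presented algebra consisting of monomials. -/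
def monomialBasis (d : ℕ) : Module.Basis (Exponent d) ℚ (Presented d) :=
  Module.Basis.mk (linearIndependent_monomial d) (by
    rw [← monomialSpan_gen_eq_top, monomialSpan]
    refine Submodule.span_mono ?_
    rintro _ ⟨a, b, c, h, rfl⟩
    exact ⟨⟨(a, b, c), h⟩, rfl⟩)

theorem monomialBasis_apply (d : ℕ) (t : Exponent d) : monomialBasis d t = monomial d t :=
  Module.Basis.mk_apply _ _ t

theorem toEnd_injective (d : ℕ) : Function.Injective (toEnd d) := by
  rw [injective_iff_map_eq_zero]
  intro x hx
  have hsum := (monomialBasis d).linearCombination_repr x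
  rw [Finsupp.linearCombination_apply, Finsupp.sum] at hsum
  simp only [monomialBasis_apply] at hsum
  have h0 := eq_zero_of_toEnd_sum_monomial d _ _ ((congrArg (toEnd d) hsum).trans hx)
  rw [← hsum]
  exact Finset.sum_eq_zero fun t ht => by rw [h0 t ht, zero_smul]

/-- The basis of `B` and the spanning family `v` share the index type `ι`, so `dim T ≤ |ι| = dim B =
dim φ.range`. -/
theorem range_eq_of_le_span {A B ι : Type*} [Ring A] [Algebra ℚ A] [Ring B] [Algebra ℚ B]
    [Finite ι] (φ : B →ₐ[ℚ] A) (hφ : Function.Injective φ) (b : Module.Basis ι ℚ B) (v : ι → A)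
    {T : Subalgebra ℚ A} (hT : φ.range ≤ T)
    (hv : Subalgebra.toSubmodule T ≤ Submodule.span ℚ (Set.range v)) : φ.range = T := by
  cases nonempty_fintype ι
  have : FiniteDimensional ℚ (Submodule.span ℚ (Set.range v)) :=
    FiniteDimensional.span_of_finite ℚ (Set.finite_range v)
  have : FiniteDimensional ℚ (Subalgebra.toSubmodule T) := Submodule.finiteDimensional_of_le hv
  refine Subalgebra.toSubmodule_injective (Submodule.eq_of_le_of_finrank_le hT ?_)
  refine ((Submodule.finrank_mono hv).trans (finrank_range_le_card v)).trans (le_of_eq ?_)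
  rw [← Module.finrank_eq_card_basis b]
  exact (AlgEquiv.ofInjective φ hφ).toLinearEquiv.finrank_eq

theorem toEnd_range (d : ℕ) : (toEnd d).range = schurAlgebra d :=
  range_eq_of_le_span (toEnd d) (toEnd_injective d) (monomialBasis d) (symmetrizedUnit d)
    (toEnd_range_le d) (schurAlgebra_le_span d)

end

end SchurTwo

theorem mainTheorem3 (d : ℕ) :
    (∃ φ : SchurTwo.Presented d ≃ₐ[ℚ] SchurTwo.schurAlgebra d,
      ∀ x : SchurTwo.Gen,
        (φ (SchurTwo.gen d x) : Module.End ℚ (SchurTwo.TensorSpace d)) =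
          SchurTwo.rho d x.toMatrix) ∧
    (∃ B : Module.Basis (SchurTwo.Exponent d) ℚ (SchurTwo.Presented d),
      ∀ t : SchurTwo.Exponent d,
        B t = SchurTwo.gen d .f ^ t.1.1 * SchurTwo.gen d .H₂ ^ t.1.2.1 *
          SchurTwo.gen d .e ^ t.1.2.2) :=
  ⟨⟨(AlgEquiv.ofInjective (SchurTwo.toEnd d) (SchurTwo.toEnd_injective d)).trans
      (Subalgebra.equivOfEq _ _ (SchurTwo.toEnd_range d)), fun x => SchurTwo.toEnd_gen d x⟩,
    SchurTwo.monomialBasis d, SchurTwo.monomialBasis_apply d⟩
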